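/- Let $-\infty\le m<M<\infty$ and let $\mathcal I$ be the closure of $(m,M)$ in $\mathbb{R}$. Let $\{W_n:n\ge1\}$ be i.i.d. real random variables with a probability density $f\ge 0$ that vanishes outside $\mathcal I$, and put $F(z)=\int_{-\infty}^z f(w)\,dw$. For $z\in\mathcal I$ and $\theta\in\mathbb{R}$ let $$\kappa(\theta|z)=\begin{cases}\theta m & \text{if } z=m>-\infty,\\ \log\dfrac{\int_{-\infty}^z e^{\theta w}f(w)\,dw}{F(z)} & \text{otherwise,}\end{cases}$$ and assume that, for every $z\in\mathcal I$, the function $\kappa(\cdot|z)$ is well defined (that is, $F(z)>0$ for $z\in\mathcal I$, $z\neq m$), finite in a neighbourhood of $\theta=0$, lower semicontinuous, and essentially smooth: it is differentiable on the nonempty interior of $\mathcal D=\{\theta:\kappa(\theta|z)<\infty\}$, and $|\partial_\theta\kappa(\theta_k|z)|\to\infty$ whenever $\theta_k$ in the interior of $\mathcal D$ converge to a boundary point of $\mathcal D$. Assume moreover that the left derivative $F'(M-)$ of $F$ at $M$ exists, is (finite and) positive, and that $f(M)=F'(M-)$. Let $\{L(n):n\ge1\}$ be a real sequence with $L(n)\to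 F'(M-)$. Let $\mu=\mathbb{E}[W_1]$, $\sigma^2=\mathrm{Var}(W_1)$ and $\sigma=\sqrt{\sigma^2}$ (under these assumptions $\mu$ and $\sigma^2$ are finite and $\sigma^2>0$), and for $n\ge1$ let $$Y_n=\frac{W_1+\cdots+W_n}{n},\qquad Z_n=\max\{W_1,\dots,W_n\}.$$ Then, for every sequence of positive numbers $\{a_n:n\ge1\}$ with $a_n\to0$ and $na_n\to\infty$, the laws $\pi_n$ on $\mathbb{R}^2$ of $$\left(\sqrt{a_n}\,\frac{Y_n-\mu}{\sigma/\sqrt n},\ a_n n L(n)(Z_n-M)\right)$$ satisfy the large deviation principle with speed $1/a_n$ and rate function $$J(y,z)=\begin{cases}\dfrac{y^2}{2}-z & \text{if } z\le0,\\ \infty & \text{otherwise,}\end{cases}$$ and $J$ is good. That is, $1/a_n\to\infty$, $J:\mathbb{R}^2\to[0,\infty]$ is lower semicontinuous, $\liminf_{n\to\infty}a_n\log\pi_n(O)\ge-\inf_{O}J$ for every open set $O\subset\mathbb{R}^2$, $\limsup_{n\to\infty}a_n\log\pi_n(C)\le-\inf_{C}J$ for every closed set $C\subset\mathbb{R}^2$,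 and every level set $\{J\le\eta\}$, $\eta\ge0$, is compact. -/

import Mathlib

open MeasureTheory ProbabilityTheory Filter Topology Set
open scoped ENNReal NNReal

namespace SumMax

noncomputable section

/-- The large deviation principle for a sequence of measures `π n` on a topological space (with its
Borel sets), with speed `v` and rate function `I`. Here `ENNReal.log 0 = ⊥`, and an infimum over the
empty set is `⊤`. -/
structure SatisfiesLDP {X : Type*} [TopologicalSpace X] [MeasurableSpace X] [BorelSpace X]
    (π : ℕ → Measure X) (v : ℕ → ℝ) (I : X → ℝ≥0∞) : Prop where
  speed : Tendsto v atTop atTop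
  lsc : LowerSemicontinuous I
  lower_bound : ∀ O : Set X, IsOpen O →
    -(⨅ x ∈ O, (I x : EReal)) ≤
      liminf (fun n => ((1 / v n : ℝ) : EReal) * ENNReal.log (π n O)) atTop
  upper_bound : ∀ C : Set X, IsClosed C →
    limsup (fun n => ((1 / v n : ℝ) : EReal) * ENNReal.log (π n C)) atTop ≤
      -(⨅ x ∈ C, (I x : EReal))

/-- A rate function is good if all its level sets are compact. -/
def IsGoodRate {X : Type*} [TopologicalSpace X] (I : X → ℝ≥0∞) : Prop :=
  ∀ η : ℝ≥0, IsCompact {x | I x ≤ (η : ℝ≥0∞)}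

/-- The effective domain `{θ : Λ θ < ∞}` of an extended real-valued function. -/
def effDomain (Λ : ℝ → EReal) : Set ℝ := {θ | Λ θ < ⊤}

/-- Essential smoothness: the effective domain has nonempty interior, `Λ` is (real-valued and)
differentiable on this interior, and `Λ` is steep. -/
structure EssentiallySmooth (Λ : ℝ → EReal) : Prop where
  nonempty : (interior (effDomain Λ)).Nonempty
  differentiable : ∀ θ ∈ interior (effDomain Λ),
    Λ θ ≠ ⊥ ∧ DifferentiableAt ℝ (fun t => (Λ t).toReal) θ
  steep : ∀ (θs : ℕ → ℝ) (b : ℝ), (∀ n, θs n ∈ interior (effDomain Λ)) →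
    b ∈ frontier (effDomain Λ) → Tendsto θs atTop (𝓝 b) →
    Tendsto (fun n => |deriv (fun t => (Λ t).toReal) (θs n)|) atTop atTop

/-- The distribution function `F z = ∫_{-∞}^z f(w) dw` of the density `f`. -/
def distFun (f : ℝ → ℝ) (z : ℝ) : ℝ := ∫ w in Iic z, f w

/-- The closure in `ℝ` of the interval `(m, M)`, where `m` may be `-∞`. -/
def closedSupport (m : EReal) (M : ℝ) : Set ℝ := {z | m ≤ (z : EReal) ∧ z ≤ M}

/-- The function `κ(θ | z)`: equal to `θ m` if `z = m > -∞`, and to the logarithm (in `[-∞, ∞]`) of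
`(∫_{-∞}^z e^{θ w} f(w) dw) / F(z)` otherwise. -/
def kappa (f : ℝ → ℝ) (m : EReal) (z θ : ℝ) : EReal :=
  open Classical in
  if (z : EReal) = m then ((θ * z : ℝ) : EReal)
  else ENNReal.log ((∫⁻ w in Iic z, ENNReal.ofReal (Real.exp (θ * w) * f w)) /
    ENNReal.ofReal (distFun f z))

/-- The conditions on a density `f` carried by the closure of `(m, M)`, `-∞ ≤ m < M < ∞`. (That `f`
has total mass one follows where it is used, since `f` is there the density of a random variable.) -/
structure DensityAssumption (f : ℝ → ℝ) (m : EReal) (M : ℝ) : Prop where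
  measurable : Measurable f
  nonneg : ∀ w, 0 ≤ f w
  lt : m < (M : EReal)
  eq_zero : ∀ w, w ∉ closedSupport m M → f w = 0
  finite_near_zero : ∀ z ∈ closedSupport m M,
    ∀ᶠ θ in 𝓝 (0 : ℝ), kappa f m z θ ≠ ⊤ ∧ kappa f m z θ ≠ ⊥
  essentiallySmooth : ∀ z ∈ closedSupport m M, EssentiallySmooth (kappa f m z)
  lsc : ∀ z ∈ closedSupport m M, LowerSemicontinuous (kappa f m z)

/-- The empirical mean `Y_n` of the first `n` variables `W 0, …, W (n - 1)`. -/
def empMean {Ω : Type*} (W : ℕ → Ω → ℝ) (n : ℕ) (ω : Ω) : ℝ :=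
  (∑ i ∈ Finset.range n, W i ω) / n

/-- The maximum `Z_n` of the first `n` variables `W 0, …, W (n - 1)` (for `n ≥ 1`). -/
def partialMax {Ω : Type*} (W : ℕ → Ω → ℝ) (n : ℕ) (ω : Ω) : ℝ :=
  ⨆ i : Fin n, W i ω

/-- The rate function: `y ^ 2 / 2 - z` if `z ≤ 0`, and `∞` otherwise. -/
def rateJ (p : ℝ × ℝ) : ℝ≥0∞ :=
  if p.2 ≤ 0 then ENNReal.ofReal (p.1 ^ 2 / 2 - p.2) else ⊤

end

end SumMax

/-!
The proof rests on the restricted Laplace transforms. Let `X n`, `T n` be the two coordinates of the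
rescaled pair. By independence, with `σ` the standard deviation, `δ n = 1 / √(a n * n)` and
`z n = M - t / L n * δ n ^ 2`,
`E[exp (θ * X n / a n); T n ≤ -t] = (E[exp (θ / σ * δ n * (W 0 - E[W 0])); W 0 ≤ z n]) ^ n`.
At the scale `δ n ^ 2` the expectation on the right is `1 + (θ ^ 2 / 2 - t) * δ n ^ 2`: the second
order expansion of the moment generating function gives the first term, and the removed mass
`P (W 0 > z n)`, known from the left derivative of the distribution function at `M`, gives the
second; the interaction of the two effects is of smaller order
(`tendsto_setIntegral_exp_sub_one_div_sq`). As `n * δ n ^ 2 = 1 / a n`, this yields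
`a n * log E[exp (θ * X n / a n); T n ≤ -t] → θ ^ 2 / 2 - t` (`laplaceAsymptotics_mean_max`).

These asymptotics, for all `θ` and all `t ≥ 0`, imply the large deviation principle
(`LaplaceAsymptotics.satisfiesLDP`). For the upper bound, Markov's inequality estimates the
probabilities of the quadrants `{T ≤ -t, θ * X ≥ θ ^ 2}`, and finitely many of these cover
`{J ≥ l}` up to an arbitrarily small loss in `l`. For the lower bound, the integral of
`exp (y * X n / a n)` over `{T n ≤ -t}` concentrates on a small box at `(y, -t)`, since the three
parts that remain have a strictly smaller exponential order by the same asymptotics with a larger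
`t` or another `θ`.
-/

namespace SumMax

/-! ### The rate function -/

lemma rateJ_le_coe_iff (p : ℝ × ℝ) (η : ℝ≥0) :
    rateJ p ≤ (η : ℝ≥0∞) ↔ p.2 ≤ 0 ∧ p.1 ^ 2 / 2 - p.2 ≤ η := by
  unfold rateJ
  split_ifs with h
  · simp [h, ENNReal.ofReal_le_iff_le_toReal]
  · simp [h]

lemma isClosed_rateJ_le (η : ℝ≥0) : IsClosed {p | rateJ p ≤ (η : ℝ≥0∞)} := by
  simp only [rateJ_le_coe_iff, ofPred_and]
  exact (isClosed_le (by fun_prop) (by fun_prop)).inter (isClosed_le (by fun_prop) (by fun_prop))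

lemma lowerSemicontinuous_rateJ : LowerSemicontinuous rateJ := by
  rw [lowerSemicontinuous_iff_isClosed_preimage]
  intro y
  induction y with
  | top => simp
  | coe η => exact isClosed_rateJ_le η

lemma isGoodRate_rateJ : IsGoodRate rateJ := by
  intro η
  refine IsCompact.of_isClosed_subset
    (isCompact_Icc (a := (-(η + 1 : ℝ), -(η : ℝ))) (b := ((η + 1 : ℝ), (0 : ℝ))))
    (isClosed_rateJ_le η) ?_
  intro p hp
  obtain ⟨h1, h2⟩ := (rateJ_le_coe_iff p η).1 hp
  have hη : (0 : ℝ) ≤ η := η.2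
  refine ⟨⟨?_, ?_⟩, ?_, h1⟩ <;> dsimp only <;> nlinarith [sq_nonneg p.1]

lemma coe_rateJ_of_nonpos {p : ℝ × ℝ} (h : p.2 ≤ 0) :
    (rateJ p : EReal) = ((p.1 ^ 2 / 2 - p.2 : ℝ) : EReal) := by
  have : 0 ≤ p.1 ^ 2 / 2 - p.2 := by nlinarith [sq_nonneg p.1]
  rw [rateJ, if_pos h, EReal.coe_ennreal_ofReal, max_eq_left this]

/-! ### Exponential estimates -/

lemma coe_le_mul_log {a r : ℝ} (ha : 0 < a) {p : ℝ≥0∞}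
    (h : ENNReal.ofReal (Real.exp (r / a)) ≤ p) : (r : EReal) ≤ (a : EReal) * ENNReal.log p := by
  have h1 := ENNReal.log_le_log h
  rw [ENNReal.log_ofReal_of_pos (Real.exp_pos _), Real.log_exp] at h1
  calc (r : EReal) = (a : EReal) * ((r / a : ℝ) : EReal) := by
        rw [← EReal.coe_mul, mul_div_cancel₀ _ ha.ne']
    _ ≤ _ := mul_le_mul_of_nonneg_left h1 (by exact_mod_cast ha.le)

lemma mul_log_le_coe {a r : ℝ} (ha : 0 < a) {p : ℝ≥0∞}
    (h : p ≤ ENNReal.ofReal (Real.exp (r / a))) : (a : EReal) * ENNReal.log p ≤ (r : EReal) := by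
  have h1 := ENNReal.log_le_log h
  rw [ENNReal.log_ofReal_of_pos (Real.exp_pos _), Real.log_exp] at h1
  calc (a : EReal) * ENNReal.log p ≤ (a : EReal) * ((r / a : ℝ) : EReal) :=
        mul_le_mul_of_nonneg_left h1 (by exact_mod_cast ha.le)
    _ = (r : EReal) := by rw [← EReal.coe_mul, mul_div_cancel₀ _ ha.ne']

lemma exp_div_le_exp_div {a x y : ℝ} (ha : 0 < a) (h : x ≤ y) :
    Real.exp (x / a) ≤ Real.exp (y / a) :=
  Real.exp_le_exp.2 (div_le_div_of_nonneg_right h ha.le)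

lemma eventually_le_exp_div {a : ℕ → ℝ} (ha_pos : ∀ᶠ n in atTop, 0 < a n)
    (ha : Tendsto a atTop (𝓝 0)) {d : ℝ} (hd : 0 < d) (c : ℝ) :
    ∀ᶠ n in atTop, c ≤ Real.exp (d / a n) := by
  have h : Tendsto (fun n => d * (a n)⁻¹) atTop atTop :=
    (tendsto_inv_nhdsGT_zero.comp
      (tendsto_nhdsWithin_iff.2 ⟨ha, ha_pos⟩)).const_mul_atTop hd
  exact (Real.tendsto_exp_atTop.comp h).eventually_ge_atTop c

section

variable {Ω : Type*} [MeasurableSpace Ω] {P : Measure Ω}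

lemma setIntegral_union_le {g : Ω → ℝ} {s t : Set Ω} (hg : ∀ ω, 0 ≤ g ω)
    (hs : IntegrableOn g s P) (ht : IntegrableOn g t P) :
    ∫ ω in s ∪ t, g ω ∂P ≤ ∫ ω in s, g ω ∂P + ∫ ω in t, g ω ∂P := by
  rw [← integral_add_measure hs ht]
  exact integral_mono_measure (Measure.restrict_union_le s t) (ae_of_all _ hg)
    (integrable_add_measure.2 ⟨hs, ht⟩)

/-- Exponential Markov inequality under the exponential tilt by `θ`: on a subset of `A` on which
`lam * b ≤ lam * X`, the tilt can be raised to `θ + lam` at the cost of `exp (- lam * b / a)`. -/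
lemma setIntegral_exp_le_of_le_mul {X : Ω → ℝ} {A B : Set Ω} {a θ lam b : ℝ} (ha : 0 < a)
    (hB : MeasurableSet B) (hBA : B ⊆ A)
    (hint : IntegrableOn (fun ω => Real.exp ((θ + lam) * X ω / a)) A P)
    (h : ∀ ω ∈ B, lam * b ≤ lam * X ω) :
    ∫ ω in B, Real.exp (θ * X ω / a) ∂P ≤
      Real.exp (-(lam * b) / a) * ∫ ω in A, Real.exp ((θ + lam) * X ω / a) ∂P := by
  calc ∫ ω in B, Real.exp (θ * X ω / a) ∂P
      ≤ ∫ ω in B, Real.exp (-(lam * b) / a) * Real.exp ((θ + lam) * X ω / a) ∂P := by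
        refine integral_mono_of_nonneg (ae_of_all _ fun _ => (Real.exp_pos _).le)
          ((hint.mono_set hBA).const_mul _) ?_
        filter_upwards [ae_restrict_mem hB] with ω hω
        rw [← Real.exp_add, ← add_div]
        gcongr
        linarith [h ω hω]
    _ = Real.exp (-(lam * b) / a) * ∫ ω in B, Real.exp ((θ + lam) * X ω / a) ∂P :=
        integral_const_mul _ _
    _ ≤ _ := by
        refine mul_le_mul_of_nonneg_left ?_ (Real.exp_pos _).le
        exact setIntegral_mono_set hint (ae_of_all _ fun _ => (Real.exp_pos _).le)
          hBA.eventuallyLE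

/-! ### From Laplace transforms on half-spaces to the large deviation principle -/

/-- The logarithmic asymptotics `a n * log E[exp (θ * X n / a n); T n ≤ -t] → θ ^ 2 / 2 - t` for all
`θ` and all `t ≥ 0`, written as two-sided exponential bounds. -/
def LaplaceAsymptotics (P : Measure Ω) (a : ℕ → ℝ) (X T : ℕ → Ω → ℝ) : Prop :=
  ∀ θ t ε : ℝ, 0 ≤ t → 0 < ε → ∀ᶠ n in atTop,
    Real.exp ((θ ^ 2 / 2 - t - ε) / a n) ≤
        ∫ ω in {ω | T n ω ≤ -t}, Real.exp (θ * X n ω / a n) ∂P ∧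
      ∫ ω in {ω | T n ω ≤ -t}, Real.exp (θ * X n ω / a n) ∂P ≤
        Real.exp ((θ ^ 2 / 2 - t + ε) / a n)

variable {a : ℕ → ℝ} {X T : ℕ → Ω → ℝ}

/-- Integrability comes for free: a Bochner integral that is not zero is that of an integrable
function. -/
lemma LaplaceAsymptotics.eventually_integrableOn (h : LaplaceAsymptotics P a X T) (θ : ℝ) {t : ℝ}
    (ht : 0 ≤ t) :
    ∀ᶠ n in atTop, IntegrableOn (fun ω => Real.exp (θ * X n ω / a n)) {ω | T n ω ≤ -t} P := by
  filter_upwards [h θ t 1 ht one_pos] with n hn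
  exact Integrable.of_integral_ne_zero ((Real.exp_pos _).trans_le hn.1).ne'

lemma LaplaceAsymptotics.eventually_measureReal_quadrant_le [IsProbabilityMeasure P]
    (h : LaplaceAsymptotics P a X T) (hX : ∀ n, Measurable (X n)) (hT : ∀ n, Measurable (T n))
    (ha_pos : ∀ᶠ n in atTop, 0 < a n) (θ : ℝ) {t ε : ℝ} (ht : 0 ≤ t) (hε : 0 < ε) :
    ∀ᶠ n in atTop, P.real {ω | T n ω ≤ -t ∧ θ * θ ≤ θ * X n ω} ≤
      Real.exp (-(θ ^ 2 / 2 + t - ε) / a n) := by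
  filter_upwards [h θ t ε ht hε, h.eventually_integrableOn θ ht, ha_pos] with n hn hint ha
  have hB : MeasurableSet {ω | T n ω ≤ -t ∧ θ * θ ≤ θ * X n ω} :=
    (measurableSet_le (hT n) measurable_const).inter
      (measurableSet_le measurable_const ((hX n).const_mul θ))
  have key := setIntegral_exp_le_of_le_mul (P := P) (X := X n) (A := {ω | T n ω ≤ -t})
    (θ := 0) (lam := θ) (b := θ) ha hB (fun ω hω => hω.1) (by simpa using hint)
    (fun ω hω => hω.2)
  simp only [zero_mul, zero_div, Real.exp_zero, zero_add, integral_const, smul_eq_mul, mul_one,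
    measureReal_restrict_apply_univ] at key
  refine key.trans ((mul_le_mul_of_nonneg_left hn.2 (Real.exp_pos _).le).trans ?_)
  rw [← Real.exp_add, ← add_div]
  gcongr
  linarith

/-- The set `{J ≥ l}` is covered by finitely many quadrants on each of which `J` is nearly `≥ l`. -/
lemma LaplaceAsymptotics.eventually_measureReal_superlevel_le [IsProbabilityMeasure P]
    (h : LaplaceAsymptotics P a X T) (hX : ∀ n, Measurable (X n)) (hT : ∀ n, Measurable (T n))
    (ha_pos : ∀ᶠ n in atTop, 0 < a n) (ha : Tendsto a atTop (𝓝 0)) (l : ℝ) {ε : ℝ}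
    (hε : 0 < ε) :
    ∀ᶠ n in atTop, P.real {ω | T n ω ≤ 0 ∧ l ≤ X n ω ^ 2 / 2 - T n ω} ≤
      Real.exp (-(l - ε) / a n) := by
  -- The mesh is `d`. For `k = N` the square root below is that of a negative number, hence `0`, and
  -- the quadrants are the half-plane `T ≤ -N * d ≤ -l`.
  obtain ⟨d, hd, hdε⟩ : ∃ d, 0 < d ∧ 3 * d = ε := ⟨ε / 3, by positivity, by ring⟩
  obtain ⟨N, hN⟩ := exists_nat_ge (l / d)
  have hNd : l ≤ N * d := (div_le_iff₀ hd).1 hN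
  set y : ℕ → ℝ := fun k => √(2 * (l - (k + 1) * d)) with hy
  have hy2 : ∀ k : ℕ, l - (k + 1) * d ≤ y k ^ 2 / 2 := by
    intro k
    rcases le_total 0 (2 * (l - (k + 1) * d)) with h0 | h0
    · simp only [hy, Real.sq_sqrt h0]; linarith
    · nlinarith [sq_nonneg (y k)]
  have hQ : ∀ᶠ n in atTop, ∀ k ∈ Finset.range (N + 1),
      P.real {ω | T n ω ≤ -(k * d) ∧ y k * y k ≤ y k * X n ω} ≤
        Real.exp (-(l - 2 * d) / a n) ∧
      P.real {ω | T n ω ≤ -(k * d) ∧ -y k * -y k ≤ -y k * X n ω} ≤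
        Real.exp (-(l - 2 * d) / a n) := by
    rw [Filter.eventually_all_finset]
    intro k _
    have hkd : 0 ≤ (k : ℝ) * d := by positivity
    filter_upwards [h.eventually_measureReal_quadrant_le hX hT ha_pos (y k) hkd hd,
      h.eventually_measureReal_quadrant_le hX hT ha_pos (-y k) hkd hd, ha_pos] with n h1 h2 hn
    constructor
    · exact h1.trans (exp_div_le_exp_div hn (by linarith [hy2 k]))
    · exact h2.trans (exp_div_le_exp_div hn (by linarith [hy2 k, neg_sq (y k)]))
  filter_upwards [hQ, ha_pos, eventually_le_exp_div ha_pos ha hd (2 * (N + 1))] with n hn han hc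
  have hcover : {ω | T n ω ≤ 0 ∧ l ≤ X n ω ^ 2 / 2 - T n ω} ⊆
      ⋃ k ∈ Finset.range (N + 1), ({ω | T n ω ≤ -(k * d) ∧ y k * y k ≤ y k * X n ω} ∪
        {ω | T n ω ≤ -(k * d) ∧ -y k * -y k ≤ -y k * X n ω}) := by
    rintro ω ⟨hT0, hl⟩
    have hfl : (⌊-T n ω / d⌋₊ : ℝ) ≤ -T n ω / d :=
      Nat.floor_le (div_nonneg (by linarith) hd.le)
    rw [le_div_iff₀ hd] at hfl
    have hfl' : -T n ω < (⌊-T n ω / d⌋₊ + 1) * d := by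
      rw [← div_lt_iff₀ hd]; exact Nat.lt_floor_add_one _
    obtain ⟨k, hk, hkT, hkX⟩ : ∃ k ∈ Finset.range (N + 1), T n ω ≤ -(k * d) ∧
        2 * (l - (k + 1) * d) ≤ X n ω ^ 2 := by
      rcases le_total ⌊-T n ω / d⌋₊ N with hle | hle
      · exact ⟨_, Finset.mem_range.2 (Nat.lt_succ_of_le hle), by linarith, by linarith⟩
      · refine ⟨N, by simp, ?_, by nlinarith [sq_nonneg (X n ω)]⟩
        have : (N : ℝ) ≤ (⌊-T n ω / d⌋₊ : ℝ) := by exact_mod_cast hle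
        nlinarith
    have hyX : y k ≤ |X n ω| := by
      rw [hy]
      exact Real.sqrt_le_iff.2 ⟨abs_nonneg _, by rwa [sq_abs]⟩
    have hy0 : 0 ≤ y k := Real.sqrt_nonneg _
    simp only [mem_iUnion]
    refine ⟨k, hk, ?_⟩
    rcases le_total 0 (X n ω) with h0 | h0
    · rw [abs_of_nonneg h0] at hyX
      exact Or.inl ⟨hkT, mul_le_mul_of_nonneg_left hyX hy0⟩
    · rw [abs_of_nonpos h0] at hyX
      exact Or.inr ⟨hkT, by nlinarith⟩
  calc P.real {ω | T n ω ≤ 0 ∧ l ≤ X n ω ^ 2 / 2 - T n ω}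
      ≤ ∑ k ∈ Finset.range (N + 1), 2 * Real.exp (-(l - 2 * d) / a n) := by
        refine (measureReal_mono hcover (measure_ne_top _ _)).trans
          ((measureReal_biUnion_finset_le _ _).trans (Finset.sum_le_sum fun k hk => ?_))
        refine (measureReal_union_le _ _).trans ?_
        linarith [(hn k hk).1, (hn k hk).2]
    _ = 2 * (N + 1) * Real.exp (-(l - 2 * d) / a n) := by
        simp only [Finset.sum_const, Finset.card_range, nsmul_eq_mul]; push_cast; ring
    _ ≤ Real.exp (d / a n) * Real.exp (-(l - 2 * d) / a n) := by gcongr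
    _ = Real.exp (-(l - ε) / a n) := by
        rw [← Real.exp_add, ← add_div, ← hdε]; congr 2; ring

/-- Under the tilt by `y₀`, the part of `{T ≤ -t}` outside a small box at `(y₀, -t)` is
exponentially negligible: its three pieces are controlled by a larger `t` and by the tilts
`y₀ ± η`. -/
lemma LaplaceAsymptotics.eventually_le_measureReal_box [IsProbabilityMeasure P]
    (h : LaplaceAsymptotics P a X T) (hX : ∀ n, Measurable (X n)) (hT : ∀ n, Measurable (T n))
    (ha_pos : ∀ᶠ n in atTop, 0 < a n) (ha : Tendsto a atTop (𝓝 0)) (y₀ : ℝ) {t η ε : ℝ}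
    (ht : 0 ≤ t) (hη : 0 < η) (hε : 0 < ε) :
    ∀ᶠ n in atTop, Real.exp (-(y₀ ^ 2 / 2 + t + |y₀| * η + ε) / a n) ≤
      P.real {ω | |X n ω - y₀| < η ∧ -(t + η) < T n ω ∧ T n ω ≤ -t} := by
  obtain ⟨d, hd, hd1, hd2, hd3⟩ : ∃ d, 0 < d ∧ 3 * d ≤ η ∧ 3 * d ≤ η ^ 2 / 2 ∧ 3 * d ≤ ε :=
    ⟨min η (min (η ^ 2 / 2) ε) / 3, by positivity,
      by linarith [min_le_left η (min (η ^ 2 / 2) ε)],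
      by linarith [min_le_right η (min (η ^ 2 / 2) ε), min_le_left (η ^ 2 / 2) ε],
      by linarith [min_le_right η (min (η ^ 2 / 2) ε), min_le_right (η ^ 2 / 2) ε]⟩
  have htη : 0 ≤ t + η := by linarith
  filter_upwards [h y₀ t d ht hd, h y₀ (t + η) d htη hd, h (y₀ + η) t d ht hd,
    h (y₀ + -η) t d ht hd, h.eventually_integrableOn y₀ ht,
    h.eventually_integrableOn (y₀ + η) ht, h.eventually_integrableOn (y₀ + -η) ht, ha_pos,
    eventually_le_exp_div ha_pos ha hd 4] with n h1 h2 h3 h4 i1 i3 i4 han hc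
  set A : Set Ω := {ω | T n ω ≤ -t} with hA
  set A' : Set Ω := {ω | T n ω ≤ -(t + η)} with hA'
  set B : Set Ω := {ω | |X n ω - y₀| < η ∧ -(t + η) < T n ω ∧ T n ω ≤ -t} with hB
  set C : Set Ω := {ω | T n ω ≤ -t ∧ y₀ + η ≤ X n ω} with hC
  set D : Set Ω := {ω | T n ω ≤ -t ∧ X n ω ≤ y₀ - η} with hD
  have mT := hT n
  have mX := hX n
  have mC : MeasurableSet C := by measurability
  have mD : MeasurableSet D := by measurability
  have mB : MeasurableSet B := by measurability
  have A'A : A' ⊆ A := fun ω hω => by simp only [hA', hA, mem_ofPred_eq] at hω ⊢; linarith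
  have BA : B ⊆ A := fun ω hω => hω.2.2
  have CA : C ⊆ A := fun ω hω => hω.1
  have DA : D ⊆ A := fun ω hω => hω.1
  have hcover : A ⊆ (B ∪ A') ∪ (C ∪ D) := by
    intro ω hω
    simp only [hA, hA', hB, hC, hD, mem_union, mem_ofPred_eq] at hω ⊢
    by_cases c1 : T n ω ≤ -(t + η)
    · exact Or.inl (Or.inr c1)
    by_cases c2 : |X n ω - y₀| < η
    · exact Or.inl (Or.inl ⟨c2, not_le.1 c1, hω⟩)
    rcases le_abs.1 (not_lt.1 c2) with c | c
    · exact Or.inr (Or.inl ⟨hω, by linarith⟩)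
    · exact Or.inr (Or.inr ⟨hω, by linarith⟩)
  set E : ℝ := Real.exp ((y₀ ^ 2 / 2 - t - 2 * d) / a n) with hE
  have hE4 : 4 * E ≤ Real.exp ((y₀ ^ 2 / 2 - t - d) / a n) := by
    calc 4 * E ≤ Real.exp (d / a n) * E := by gcongr
      _ = _ := by rw [hE, ← Real.exp_add, ← add_div]; congr 2; ring
  have bA' : ∫ ω in A', Real.exp (y₀ * X n ω / a n) ∂P ≤ E := by
    exact h2.2.trans (exp_div_le_exp_div han (by linarith))
  have bC : ∫ ω in C, Real.exp (y₀ * X n ω / a n) ∂P ≤ E := by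
    refine (setIntegral_exp_le_of_le_mul (b := y₀ + η) han mC CA i3
      (fun ω hω => mul_le_mul_of_nonneg_left hω.2 hη.le)).trans
      ((mul_le_mul_of_nonneg_left h3.2 (Real.exp_pos _).le).trans ?_)
    rw [hE, ← Real.exp_add, ← add_div]
    gcongr
    nlinarith
  have bD : ∫ ω in D, Real.exp (y₀ * X n ω / a n) ∂P ≤ E := by
    refine (setIntegral_exp_le_of_le_mul (b := y₀ - η) han mD DA i4
      (fun ω hω => mul_le_mul_of_nonpos_left hω.2 (by linarith))).trans
      ((mul_le_mul_of_nonneg_left h4.2 (Real.exp_pos _).le).trans ?_)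
    rw [hE, ← Real.exp_add, ← add_div]
    gcongr
    nlinarith
  have hpos : ∀ ω, 0 ≤ Real.exp (y₀ * X n ω / a n) := fun _ => (Real.exp_pos _).le
  have hsum : ∫ ω in A, Real.exp (y₀ * X n ω / a n) ∂P ≤
      (∫ ω in B, Real.exp (y₀ * X n ω / a n) ∂P + ∫ ω in A', Real.exp (y₀ * X n ω / a n) ∂P) +
      (∫ ω in C, Real.exp (y₀ * X n ω / a n) ∂P + ∫ ω in D, Real.exp (y₀ * X n ω / a n) ∂P) := by
    have iB := i1.mono_set BA
    have iA' := i1.mono_set A'A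
    have iC := i1.mono_set CA
    have iD := i1.mono_set DA
    exact (setIntegral_mono_set ((iB.union iA').union (iC.union iD)) (ae_of_all _ hpos)
      hcover.eventuallyLE).trans ((setIntegral_union_le hpos (iB.union iA') (iC.union iD)).trans
      (add_le_add (setIntegral_union_le hpos iB iA') (setIntegral_union_le hpos iC iD)))
  have hEB : E ≤ ∫ ω in B, Real.exp (y₀ * X n ω / a n) ∂P := by linarith [h1.1]
  have hBle : ∫ ω in B, Real.exp (y₀ * X n ω / a n) ∂P ≤
      P.real B * Real.exp ((y₀ ^ 2 + |y₀| * η) / a n) := by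
    rw [← smul_eq_mul, ← setIntegral_const]
    refine setIntegral_mono_on (i1.mono_set BA) (integrableOn_const (measure_ne_top _ _)) mB ?_
    intro ω hω
    gcongr
    have h5 : y₀ * (X n ω - y₀) ≤ |y₀| * η :=
      (le_abs_self _).trans
        (by rw [abs_mul]; exact mul_le_mul_of_nonneg_left hω.1.le (abs_nonneg _))
    nlinarith
  have := hEB.trans hBle
  rw [← div_le_iff₀ (Real.exp_pos _), hE, ← Real.exp_sub, ← sub_div] at this
  refine le_trans ?_ this
  gcongr
  linarith

/-- The large deviation principle for `(X n, T n)` follows from the asymptotics of the Laplace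
transforms of `X n` restricted to the events `{T n ≤ -t}`. -/
theorem LaplaceAsymptotics.satisfiesLDP [IsProbabilityMeasure P]
    (h : LaplaceAsymptotics P a X T) (hX : ∀ n, Measurable (X n)) (hT : ∀ n, Measurable (T n))
    (ha_pos : ∀ᶠ n in atTop, 0 < a n) (ha : Tendsto a atTop (𝓝 0))
    (hT0 : ∀ᶠ n in atTop, ∀ᵐ ω ∂P, T n ω ≤ 0) :
    SatisfiesLDP (fun n => P.map (fun ω => (X n ω, T n ω))) (fun n => 1 / a n) rateJ where
  speed := by
    simp only [one_div]
    exact tendsto_inv_nhdsGT_zero.comp (tendsto_nhdsWithin_iff.2 ⟨ha, ha_pos⟩)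
  lsc := lowerSemicontinuous_rateJ
  lower_bound O hO := by
    simp only [one_div, inv_inv]
    rw [← EReal.ge_of_forall_gt_iff_ge]
    intro z hz
    rw [EReal.lt_neg_comm] at hz
    simp only [iInf_lt_iff, exists_prop] at hz
    obtain ⟨⟨y₀, z₀⟩, hp, hlt⟩ := hz
    have hz₀ : z₀ ≤ 0 := by
      by_contra hcon
      simp [rateJ, hcon] at hlt
    rw [coe_rateJ_of_nonpos hz₀, ← EReal.coe_neg, EReal.coe_lt_coe_iff] at hlt
    dsimp only at hlt
    obtain ⟨r, hr, hball⟩ := Metric.isOpen_iff.1 hO _ hp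
    obtain ⟨ε, hε, hεz⟩ : ∃ ε, 0 < ε ∧ y₀ ^ 2 / 2 - z₀ + 2 * ε = -z :=
      ⟨(-z - (y₀ ^ 2 / 2 - z₀)) / 2, by linarith, by ring⟩
    obtain ⟨η, hη, hηr, hηε⟩ : ∃ η, 0 < η ∧ η ≤ r ∧ |y₀| * η ≤ ε := by
      refine ⟨min r (ε / (|y₀| + 1)), by positivity, min_le_left _ _, ?_⟩
      calc |y₀| * min r (ε / (|y₀| + 1)) ≤ (|y₀| + 1) * (ε / (|y₀| + 1)) := by
            gcongr
            · linarith
            · exact min_le_right _ _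
        _ = ε := by field_simp
    refine le_liminf_of_le (by isBoundedDefault) ?_
    filter_upwards [h.eventually_le_measureReal_box hX hT ha_pos ha y₀ (t := -z₀) (by linarith) hη
      hε, ha_pos] with n hn han
    refine coe_le_mul_log han ?_
    rw [Measure.map_apply ((hX n).prodMk (hT n)) hO.measurableSet]
    refine le_trans ?_ (measure_mono (μ := P)
      (s := {ω | |X n ω - y₀| < η ∧ -(-z₀ + η) < T n ω ∧ T n ω ≤ - -z₀}) ?_)
    · rw [← ofReal_measureReal]
      refine ENNReal.ofReal_le_ofReal (le_trans ?_ hn)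
      gcongr
      linarith
    · rintro ω ⟨h1, h2, h3⟩
      refine hball ?_
      rw [Metric.mem_ball, Prod.dist_eq, Real.dist_eq, Real.dist_eq]
      exact max_lt (h1.trans_le hηr) (by rw [abs_lt]; constructor <;> dsimp only <;> linarith)
  upper_bound C hC := by
    simp only [one_div, inv_inv]
    rw [← EReal.le_of_forall_lt_iff_le]
    intro z hz
    obtain ⟨z', hz1, hz2⟩ := EReal.lt_iff_exists_real_btwn.1 hz
    rw [EReal.coe_lt_coe_iff] at hz2
    rw [EReal.neg_lt_comm, ← EReal.coe_neg] at hz1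
    refine limsup_le_of_le (by isBoundedDefault) ?_
    filter_upwards [h.eventually_measureReal_superlevel_le hX hT ha_pos ha (-z')
      (sub_pos.2 hz2), ha_pos, hT0] with n hn han hT0n
    refine mul_log_le_coe han ?_
    rw [Measure.map_apply ((hX n).prodMk (hT n)) hC.measurableSet]
    refine (measure_mono_ae (t := {ω | T n ω ≤ 0 ∧ -z' ≤ X n ω ^ 2 / 2 - T n ω}) ?_).trans ?_
    · filter_upwards [hT0n] with ω hω hωC
      refine ⟨hω, ?_⟩
      have h2 := hz1.le.trans (iInf₂_le (X n ω, T n ω) hωC)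
      rwa [coe_rateJ_of_nonpos hω, EReal.coe_le_coe_iff] at h2
    · rw [← ofReal_measureReal]
      refine ENNReal.ofReal_le_ofReal (hn.trans (le_of_eq ?_))
      congr 2
      ring

end

/-! ### One variable: expansion of the restricted moment generating function -/

section

variable {Ω : Type*} [MeasurableSpace Ω] {P : Measure Ω}

lemma zero_mem_interior_integrableExpSet_sub_const {X : Ω → ℝ}
    (h : 0 ∈ interior (integrableExpSet X P)) (c : ℝ) :
    0 ∈ interior (integrableExpSet (fun ω => X ω - c) P) := by
  rw [mem_interior_iff_mem_nhds] at h ⊢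
  filter_upwards [h] with t ht
  have : (fun ω => Real.exp (t * (X ω - c))) =
      fun ω => Real.exp (t * X ω) * Real.exp (-(t * c)) := by
    ext ω
    rw [← Real.exp_add]
    ring_nf
  change Integrable _ P
  rw [this]
  exact Integrable.mul_const ht _

lemma mgf_sub_taylor_isLittleO [IsProbabilityMeasure P] {X : Ω → ℝ}
    (h : 0 ∈ interior (integrableExpSet X P))
    (h0 : P[X] = 0) :
    (fun s => mgf X P s - (1 + variance X P / 2 * s ^ 2)) =o[𝓝 0] fun s => s ^ 2 := by
  have hX : AEMeasurable X P := aemeasurable_of_mem_interior_integrableExpSet h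
  have h1 := (hasFPowerSeriesAt_mgf h).isBigO_sub_partialSum_pow 3
  simp only [zero_add, FormalMultilinearSeries.partialSum, Finset.sum_range_succ,
    Finset.sum_range_zero, FormalMultilinearSeries.ofScalars_apply_eq, zero_mul, Real.exp_zero,
    mul_one, pow_zero, pow_one, Nat.factorial] at h1
  have h2 := h1.trans_isLittleO (k := fun s : ℝ => ‖s‖ ^ 2) ?_
  · rw [variance_of_integral_eq_zero hX h0]
    simpa [h0, div_eq_inv_mul, mul_comm, mul_assoc] using h2
  · exact (Asymptotics.isLittleO_pow_pow (by norm_num)).comp_tendsto tendsto_norm_zero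

lemma tendsto_mgf_sub_one_div_sq [IsProbabilityMeasure P] {X : Ω → ℝ}
    (h : 0 ∈ interior (integrableExpSet X P)) (h0 : P[X] = 0) {δ : ℕ → ℝ}
    (hδ : Tendsto δ atTop (𝓝 0)) (hδ_pos : ∀ᶠ n in atTop, 0 < δ n) (c : ℝ) :
    Tendsto (fun n => (mgf X P (c * δ n) - 1) / δ n ^ 2) atTop
      (𝓝 (c ^ 2 * variance X P / 2)) := by
  have hs : Tendsto (fun n => c * δ n) atTop (𝓝 0) := by simpa using hδ.const_mul c
  have h1 : (fun n => mgf X P (c * δ n) - (1 + variance X P / 2 * (c * δ n) ^ 2)) =o[atTop]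
      fun n => δ n ^ 2 := by
    refine ((mgf_sub_taylor_isLittleO h h0).comp_tendsto hs).trans_isBigO ?_
    refine Asymptotics.IsBigO.of_bound (c ^ 2) (Eventually.of_forall fun n => ?_)
    simp [mul_pow]
  have h2 := h1.tendsto_div_nhds_zero.add_const (c ^ 2 * variance X P / 2)
  rw [zero_add] at h2
  refine h2.congr' ?_
  filter_upwards [hδ_pos] with n hn
  field_simp
  ring

/-- If the distribution function of `X ≤ M` has left derivative `p` at `M`, then
`P (X > M - r * δ ^ 2) ~ p * r * δ ^ 2`. -/
lemma tendsto_measureReal_gt_div_sq [IsProbabilityMeasure P] {X : Ω → ℝ} (hX : Measurable X)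
    {M p : ℝ} (hXM : ∀ᵐ ω ∂P, X ω ≤ M)
    (hderiv : HasDerivWithinAt (fun z => P.real {ω | X ω ≤ z}) p (Iic M) M) {δ r : ℕ → ℝ}
    (hδ : Tendsto δ atTop (𝓝 0)) (hδ_pos : ∀ᶠ n in atTop, 0 < δ n) {r₀ : ℝ}
    (hr : Tendsto r atTop (𝓝 r₀)) (hr_nonneg : ∀ᶠ n in atTop, 0 ≤ r n) :
    Tendsto (fun n => P.real {ω | M - r n * δ n ^ 2 < X ω} / δ n ^ 2) atTop (𝓝 (p * r₀)) := by
  have hM : P.real {ω | X ω ≤ M} = 1 := by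
    rw [measureReal_congr (eventuallyEq_univ.2 hXM), probReal_univ]
  have hz : Tendsto (fun n => M - r n * δ n ^ 2) atTop (𝓝[≤] M) := by
    refine tendsto_nhdsWithin_iff.2 ⟨?_, ?_⟩
    · simpa using (hr.mul (hδ.pow 2)).const_sub M
    · filter_upwards [hr_nonneg] with n hn
      rw [mem_Iic]
      nlinarith [sq_nonneg (δ n)]
  have h1 := (hderiv.isLittleO.comp_tendsto hz).trans_isBigO (k := fun n => δ n ^ 2) (by
    simp only [Function.comp_def, sub_sub_cancel_left]
    refine Asymptotics.IsBigO.neg_left ?_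
    simpa using (hr.isBigO_one ℝ).mul (Asymptotics.isBigO_refl (fun n => δ n ^ 2) atTop))
  have h2 := (hr.const_mul p).sub h1.tendsto_div_nhds_zero
  rw [sub_zero] at h2
  refine h2.congr' ?_
  filter_upwards [hδ_pos] with n hn
  have hc : {ω | M - r n * δ n ^ 2 < X ω} = {ω | X ω ≤ M - r n * δ n ^ 2}ᶜ := by
    ext ω; simp
  rw [hc, probReal_compl_eq_one_sub (measurableSet_le hX measurable_const)]
  simp only [Function.comp_apply, hM, smul_eq_mul]
  field_simp
  ring

/-- The two effects on the restricted moment generating function add up at the scale `δ ^ 2`: the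
tilt contributes half the variance, the restriction to `{X ≤ M - r * δ ^ 2}` removes the mass
`p * r * δ ^ 2`. -/
lemma tendsto_setIntegral_exp_sub_one_div_sq [IsProbabilityMeasure P] {X : Ω → ℝ}
    (hX : Measurable X) (h : 0 ∈ interior (integrableExpSet X P))
    {M p : ℝ} (hXM : ∀ᵐ ω ∂P, X ω ≤ M)
    (hderiv : HasDerivWithinAt (fun z => P.real {ω | X ω ≤ z}) p (Iic M) M) {δ r : ℕ → ℝ}
    (hδ : Tendsto δ atTop (𝓝 0)) (hδ_pos : ∀ᶠ n in atTop, 0 < δ n) {r₀ : ℝ}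
    (hr : Tendsto r atTop (𝓝 r₀)) (hr_nonneg : ∀ᶠ n in atTop, 0 ≤ r n) (c : ℝ) :
    Tendsto (fun n => (∫ ω in {ω | X ω ≤ M - r n * δ n ^ 2},
        Real.exp (c * δ n * (X ω - P[X])) ∂P - 1) / δ n ^ 2) atTop
      (𝓝 (c ^ 2 * variance X P / 2 - p * r₀)) := by
  set X' : Ω → ℝ := fun ω => X ω - P[X] with hX'
  have hint : Integrable X P := integrable_of_mem_interior_integrableExpSet h
  have h' : 0 ∈ interior (integrableExpSet X' P) :=
    zero_mem_interior_integrableExpSet_sub_const h _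
  have h0 : P[X'] = 0 := by
    simp [hX', integral_sub hint (integrable_const _)]
  have hvar : variance X' P = variance X P := variance_sub_const hX.aestronglyMeasurable _
  have hs : Tendsto (fun n => c * δ n) atTop (𝓝 0) := by simpa using hδ.const_mul c
  have hmgf := tendsto_mgf_sub_one_div_sq h' h0 hδ hδ_pos c
  have htail := tendsto_measureReal_gt_div_sq hX hXM hderiv hδ hδ_pos hr hr_nonneg
  have hz : Tendsto (fun n => M - r n * δ n ^ 2) atTop (𝓝 M) := by
    simpa using (hr.mul (hδ.pow 2)).const_sub M
  -- On the removed event `X` stays within `K` of its mean, so there the tilt is `1 + O(δ)`.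
  set K : ℝ := |M - P[X]| + 1 with hK
  have herr : Tendsto (fun n => (∫ ω in {ω | M - r n * δ n ^ 2 < X ω},
      Real.exp (c * δ n * X' ω) ∂P - P.real {ω | M - r n * δ n ^ 2 < X ω}) / δ n ^ 2) atTop
      (𝓝 0) := by
    have hb : Tendsto (fun n => 2 * (|c * δ n| * K) *
        (P.real {ω | M - r n * δ n ^ 2 < X ω} / δ n ^ 2)) atTop (𝓝 0) := by
      have := (((hs.abs.mul_const K).const_mul 2).mul htail)
      simpa using this
    refine squeeze_zero_norm' ?_ hb
    have hsmall : ∀ᶠ n in atTop, |c * δ n| * K ≤ 1 := by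
      have : Tendsto (fun n => |c * δ n| * K) atTop (𝓝 0) := by simpa using hs.abs.mul_const K
      exact this.eventually_le_const one_pos
    filter_upwards [hsmall, hδ_pos, hz.eventually_const_le (show M - 1 < M by linarith),
      hs.eventually_mem (mem_interior_iff_mem_nhds.1 h')] with n h1 hδn h2 h3
    rw [norm_div, Real.norm_of_nonneg (sq_nonneg (δ n)), mul_div_assoc']
    gcongr
    have e : P.real {ω | M - r n * δ n ^ 2 < X ω} =
        ∫ ω in {ω | M - r n * δ n ^ 2 < X ω}, (1 : ℝ) ∂P := by simp
    nth_rewrite 1 [e]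
    rw [← integral_sub (Integrable.integrableOn h3) (integrable_const _)]
    refine norm_setIntegral_le_of_norm_le_const_ae' (measure_lt_top _ _) ?_
    filter_upwards [hXM] with ω hω hω2
    have hXK : |X' ω| ≤ K := by
      have hω3 : M - r n * δ n ^ 2 < X ω := hω2
      have : X' ω = (M - P[X]) + (X ω - M) := by simp only [hX']; ring
      rw [this]
      refine (abs_add_le _ _).trans (add_le_add le_rfl ?_)
      rw [abs_le]
      constructor <;> linarith
    have hle : |c * δ n * X' ω| ≤ |c * δ n| * K := by
      rw [abs_mul]; exact mul_le_mul_of_nonneg_left hXK (abs_nonneg _)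
    exact (Real.abs_exp_sub_one_le (hle.trans h1)).trans (by linarith)
  have hlim := (hmgf.sub htail).sub herr
  rw [hvar, sub_zero] at hlim
  refine hlim.congr' ?_
  filter_upwards [hδ_pos, hs.eventually_mem (mem_interior_iff_mem_nhds.1 h')] with n hn h3
  have hm : MeasurableSet {ω | X ω ≤ M - r n * δ n ^ 2} := measurableSet_le hX measurable_const
  have hsplit := integral_add_compl hm (show Integrable _ P from h3)
  have hc : {ω | X ω ≤ M - r n * δ n ^ 2}ᶜ = {ω | M - r n * δ n ^ 2 < X ω} := by
    ext ω; simp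
  rw [hc] at hsplit
  rw [mgf, ← hsplit]
  ring

end

/-! ### Powers of the one-variable integrals -/

/-- If `(u n - 1) / δ n ^ 2 → K` and `n * δ n ^ 2 = 1 / a n`, then `u n ^ n` is of exponential order
`K` at the speed `1 / a n`. -/
lemma eventually_exp_le_pow {a δ u : ℕ → ℝ} {K : ℝ} (ha_pos : ∀ᶠ n in atTop, 0 < a n)
    (hδ : Tendsto δ atTop (𝓝 0)) (hδa : ∀ᶠ n : ℕ in atTop, n * δ n ^ 2 = 1 / a n)
    (hu : Tendsto (fun n => (u n - 1) / δ n ^ 2) atTop (𝓝 K)) {ε : ℝ} (hε : 0 < ε) :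
    ∀ᶠ n in atTop, Real.exp ((K - ε) / a n) ≤ u n ^ n ∧
      u n ^ n ≤ Real.exp ((K + ε) / a n) := by
  have hδ0 : ∀ᶠ n in atTop, δ n ^ 2 ≠ 0 := by
    filter_upwards [hδa, ha_pos] with n h1 h2 h3
    rw [h3, mul_zero] at h1
    exact (one_div_pos.2 h2).ne h1
  have hu1 : Tendsto u atTop (𝓝 1) := by
    have := (hu.mul (hδ.pow 2)).add_const 1
    simp only [ne_eq, OfNat.ofNat_ne_zero, not_false_eq_true, zero_pow, mul_zero, zero_add] at this
    refine this.congr' ?_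
    filter_upwards [hδ0] with n hn
    rw [div_mul_cancel₀ _ hn, sub_add_cancel]
  have hu_pos : ∀ᶠ n in atTop, 0 < u n := hu1.eventually_const_lt one_pos
  -- `1 - 1 / u ≤ log u ≤ u - 1`, and both bounds are `K * δ ^ 2` to first order.
  have hlog : Tendsto (fun n => Real.log (u n) / δ n ^ 2) atTop (𝓝 K) := by
    have hlow : Tendsto (fun n => (u n - 1) / δ n ^ 2 * (u n)⁻¹) atTop (𝓝 K) := by
      simpa using hu.mul (hu1.inv₀ one_ne_zero)
    refine tendsto_of_tendsto_of_tendsto_of_le_of_le' hlow hu ?_ ?_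
    · filter_upwards [hu_pos] with n hn
      calc (u n - 1) / δ n ^ 2 * (u n)⁻¹ = (1 - (u n)⁻¹) / δ n ^ 2 := by field_simp
        _ ≤ _ := by gcongr; exact Real.one_sub_inv_le_log_of_pos hn
    · filter_upwards [hu_pos] with n hn
      gcongr
      exact Real.log_le_sub_one_of_pos hn
  filter_upwards [hu_pos, hδ0, hδa, ha_pos, hlog.eventually_const_le (show K - ε < K by linarith),
    hlog.eventually_le_const (show K < K + ε by linarith)] with n hn h0 h1 h2 h3 h4
  have hpow : u n ^ n = Real.exp ((Real.log (u n) / δ n ^ 2) / a n) := by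
    rw [← Real.exp_log (pow_pos hn n), Real.log_pow, div_eq_mul_one_div _ (a n), ← h1,
      mul_comm (n : ℝ) (δ n ^ 2), ← mul_assoc, div_mul_cancel₀ _ h0, mul_comm]
  rw [hpow]
  exact ⟨exp_div_le_exp_div h2 h3, exp_div_le_exp_div h2 h4⟩

/-! ### Consequences of the assumptions on the density -/

section

variable {Ω : Type*} [MeasurableSpace Ω] {P : Measure Ω} {X : Ω → ℝ} {f : ℝ → ℝ} {m : EReal}
  {M : ℝ}

lemma measureReal_le_eq_distFun (hX : Measurable X) (hf : DensityAssumption f m M)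
    (hlaw : P.map X = volume.withDensity (fun w => ENNReal.ofReal (f w))) (z : ℝ) :
    P.real {ω | X ω ≤ z} = distFun f z := by
  have : P.real {ω | X ω ≤ z} = (P.map X).real (Iic z) :=
    (map_measureReal_apply hX measurableSet_Iic).symm
  rw [this, measureReal_def, hlaw, withDensity_apply _ measurableSet_Iic, distFun,
    integral_eq_lintegral_of_nonneg_ae (ae_of_all _ hf.nonneg)
      hf.measurable.aestronglyMeasurable]

lemma ae_le_of_densityAssumption (hX : Measurable X) (hf : DensityAssumption f m M)
    (hlaw : P.map X = volume.withDensity (fun w => ENNReal.ofReal (f w))) :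
    ∀ᵐ ω ∂P, X ω ≤ M := by
  refine ae_of_ae_map hX.aemeasurable (p := fun w => w ≤ M) ?_
  rw [hlaw, ae_withDensity_iff hf.measurable.ennreal_ofReal]
  refine ae_of_all _ fun w hw => ?_
  by_contra hcon
  exact hw (by rw [hf.eq_zero w fun h => hcon h.2, ENNReal.ofReal_zero])

/-- Finiteness of `κ(· | M)` near `0` is finiteness of the moment generating function near `0`. -/
lemma zero_mem_interior_integrableExpSet (hX : Measurable X) (hf : DensityAssumption f m M)
    (hlaw : P.map X = volume.withDensity (fun w => ENNReal.ofReal (f w))) :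
    0 ∈ interior (integrableExpSet X P) := by
  rw [mem_interior_iff_mem_nhds]
  filter_upwards [hf.finite_near_zero M ⟨hf.lt.le, le_rfl⟩] with θ hθ
  have hne : ∫⁻ w in Iic M, ENNReal.ofReal (Real.exp (θ * w) * f w) ≠ ⊤ := by
    intro htop
    refine hθ.1 ?_
    rw [kappa, if_neg hf.lt.ne', htop, ENNReal.top_div_of_ne_top ENNReal.ofReal_ne_top,
      ENNReal.log_top]
  have hexp : Measurable fun w : ℝ => Real.exp (θ * w) := by fun_prop
  change Integrable ((fun w => Real.exp (θ * w)) ∘ X) P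
  rw [← integrable_map_measure hexp.aestronglyMeasurable hX.aemeasurable]
  refine ⟨hexp.aestronglyMeasurable, ?_⟩
  rw [hasFiniteIntegral_iff_ofReal (ae_of_all _ fun _ => (Real.exp_pos _).le), hlaw,
    lintegral_withDensity_eq_lintegral_mul _ hf.measurable.ennreal_ofReal hexp.ennreal_ofReal,
    lt_top_iff_ne_top]
  rw [← lintegral_indicator measurableSet_Iic] at hne
  convert hne using 1
  refine lintegral_congr fun w => ?_
  by_cases hw : w ≤ M
  · rw [indicator_of_mem (mem_Iic.2 hw), Pi.mul_apply, mul_comm (Real.exp _),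
      ENNReal.ofReal_mul (hf.nonneg w)]
  · rw [indicator_of_notMem (mt mem_Iic.1 hw), Pi.mul_apply, hf.eq_zero w fun h => hw h.2,
      ENNReal.ofReal_zero, zero_mul]

lemma variance_pos_of_law_withDensity [IsProbabilityMeasure P] (hX : Measurable X)
    (h : 0 ∈ interior (integrableExpSet X P))
    (hlaw : P.map X = volume.withDensity (fun w => ENNReal.ofReal (f w))) :
    0 < variance X P := by
  refine (variance_nonneg X P).lt_of_ne' fun h0 => ?_
  have hae : ∀ᵐ ω ∂P, X ω = P[X] :=
    ae_eq_integral_of_variance_eq_zero (memLp_of_mem_interior_integrableExpSet h 2) h0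
  have h1 : P.map X {P[X]} = 1 := by
    rw [Measure.map_apply hX (measurableSet_singleton _)]
    exact (measure_congr (eventuallyEq_univ.2 hae)).trans measure_univ
  rw [hlaw, withDensity_absolutelyContinuous _ _ Real.volume_singleton] at h1
  exact zero_ne_one h1

end

/-! ### Independent variables: sums restricted by the maximum -/

lemma partialMax_le_iff {Ω : Type*} {W : ℕ → Ω → ℝ} {n : ℕ} (hn : n ≠ 0) {ω : Ω}
    {z : ℝ} :
    partialMax W n ω ≤ z ↔ ∀ i : Fin n, W i ω ≤ z := by
  have : Nonempty (Fin n) := ⟨⟨0, Nat.pos_of_ne_zero hn⟩⟩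
  exact ciSup_le_iff (Set.finite_range _).bddAbove

section

variable {Ω : Type*} [MeasurableSpace Ω] {P : Measure Ω} {W : ℕ → Ω → ℝ}

lemma measurable_partialMax (hW : ∀ i, Measurable (W i)) (n : ℕ) :
    Measurable (partialMax W n) :=
  Measurable.iSup fun i : Fin n => hW i

lemma setIntegral_exp_sum_eq_pow (hW : ∀ i, Measurable (W i)) (hind : iIndepFun W P)
    (hid : ∀ i, P.map (W i) = P.map (W 0)) {n : ℕ} (hn : n ≠ 0) (s c z : ℝ) :
    ∫ ω in {ω | partialMax W n ω ≤ z},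
        Real.exp (s * ∑ i ∈ Finset.range n, (W i ω - c)) ∂P =
      (∫ ω in {ω | W 0 ω ≤ z}, Real.exp (s * (W 0 ω - c)) ∂P) ^ n := by
  set φ : ℝ → ℝ := (Iic z).indicator fun w => Real.exp (s * (w - c)) with hφ
  have hφm : Measurable φ := by
    refine Measurable.indicator ?_ measurableSet_Iic
    fun_prop
  have hone : ∀ i, ∫ ω, φ (W i ω) ∂P = ∫ ω in {ω | W 0 ω ≤ z}, Real.exp (s * (W 0 ω - c)) ∂P := by
    intro i
    rw [← integral_map (hW i).aemeasurable hφm.aestronglyMeasurable, hid i,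
      integral_map (hW 0).aemeasurable hφm.aestronglyMeasurable,
      ← integral_indicator (measurableSet_le (hW 0) measurable_const)]
    rfl
  have hprod := (hind.precomp (Fin.val_injective (n := n))).integral_fun_prod_comp
    (f := fun _ => φ) (fun i => (hW i).aemeasurable) (fun _ => hφm.aestronglyMeasurable)
  simp only [hone, Finset.prod_const, Finset.card_univ,
    Fintype.card_fin] at hprod
  rw [← hprod, ← integral_indicator (measurableSet_le (measurable_partialMax hW n)
    measurable_const)]
  congr 1
  ext ω
  by_cases h : partialMax W n ω ≤ z
  · have h' := (partialMax_le_iff hn).1 h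
    rw [indicator_of_mem (by exact h), Finset.mul_sum, Real.exp_sum, Finset.prod_range]
    exact Finset.prod_congr rfl fun i _ => (indicator_of_mem (mem_Iic.2 (h' i))
      fun w => Real.exp (s * (w - c))).symm
  · rw [indicator_of_notMem (by exact h)]
    rw [partialMax_le_iff hn] at h
    push Not at h
    obtain ⟨i, hi⟩ := h
    exact (Finset.prod_eq_zero (Finset.mem_univ i)
      (indicator_of_notMem (mt mem_Iic.1 (not_le.2 hi)) _)).symm

/-- The restricted Laplace transforms of the rescaled mean and maximum. The relevant scale is
`δ n = 1 / √(a n * n)`: the tilt of each variable is `θ / σ * δ n`, and the threshold `-t` for the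
rescaled maximum is the threshold `M - t / L n * δ n ^ 2` for each variable. -/
lemma laplaceAsymptotics_mean_max [IsProbabilityMeasure P] (hW : ∀ i, Measurable (W i)) (hind : iIndepFun W P)
    (hid : ∀ i, P.map (W i) = P.map (W 0)) (h0 : 0 ∈ interior (integrableExpSet (W 0) P)) {M p : ℝ} (hWM : ∀ᵐ ω ∂P, W 0 ω ≤ M)
    (hderiv : HasDerivWithinAt (fun z => P.real {ω | W 0 ω ≤ z}) p (Iic M) M) (hp : 0 < p)
    (hvar : 0 < variance (W 0) P) {L a : ℕ → ℝ} (hL : Tendsto L atTop (𝓝 p))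
    (ha_pos : ∀ᶠ n in atTop, 0 < a n) (ha_top : Tendsto (fun n : ℕ => a n * n) atTop atTop) :
    LaplaceAsymptotics P a
      (fun n ω => √(a n) * ((empMean W n ω - P[W 0]) / (√(variance (W 0) P) / √(n : ℝ))))
      (fun n ω => a n * n * L n * (partialMax W n ω - M)) := by
  intro θ t ε ht hε
  set σ : ℝ := √(variance (W 0) P) with hσ
  have hσ_pos : 0 < σ := Real.sqrt_pos.2 hvar
  have hσ2 : variance (W 0) P = σ ^ 2 := (Real.sq_sqrt hvar.le).symm
  set δ : ℕ → ℝ := fun n => (√(a n * n))⁻¹ with hδ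
  have hδ0 : Tendsto δ atTop (𝓝 0) :=
    tendsto_inv_atTop_zero.comp (Real.tendsto_sqrt_atTop.comp ha_top)
  have han : ∀ᶠ n : ℕ in atTop, 0 < a n * n := ha_top.eventually_gt_atTop 0
  have hδ_pos : ∀ᶠ n in atTop, 0 < δ n := by
    filter_upwards [han] with n hn
    exact inv_pos.2 (Real.sqrt_pos.2 hn)
  have hδ2 : ∀ᶠ n : ℕ in atTop, δ n ^ 2 = (a n * n)⁻¹ := by
    filter_upwards [han] with n hn
    rw [hδ, inv_pow, Real.sq_sqrt hn.le]
  have hL_pos : ∀ᶠ n in atTop, 0 < L n := hL.eventually_const_lt hp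
  have hr : Tendsto (fun n => t / L n) atTop (𝓝 (t / p)) :=
    tendsto_const_nhds.div hL hp.ne'
  have hu := tendsto_setIntegral_exp_sub_one_div_sq (hW 0) h0 hWM hderiv hδ0 hδ_pos hr
    (by filter_upwards [hL_pos] with n hn using div_nonneg ht hn.le) (θ / σ)
  have hK : (θ / σ) ^ 2 * variance (W 0) P / 2 - p * (t / p) = θ ^ 2 / 2 - t := by
    rw [hσ2]
    field_simp
  rw [hK] at hu
  have hδa : ∀ᶠ n : ℕ in atTop, n * δ n ^ 2 = 1 / a n := by
    filter_upwards [hδ2, ha_pos, eventually_ne_atTop 0] with n hn h1 h2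
    rw [hn]
    field_simp
  filter_upwards [eventually_exp_le_pow ha_pos hδ0 hδa hu hε, ha_pos, eventually_ne_atTop 0, hδ2,
    hL_pos] with n hn h1 h2 h3 h4
  have hn0 : (0 : ℝ) < n := Nat.cast_pos.2 (Nat.pos_of_ne_zero h2)
  have hset : {ω | a n * n * L n * (partialMax W n ω - M) ≤ -t} =
      {ω | partialMax W n ω ≤ M - t / L n * δ n ^ 2} := by
    ext ω
    have e : t = a n * n * L n * (t / L n * δ n ^ 2) := by rw [h3]; field_simp
    have hc : 0 < a n * n * L n := by positivity
    simp only [mem_ofPred_eq]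
    nth_rewrite 1 [e]
    rw [← mul_neg, mul_le_mul_iff_right₀ hc]
    constructor <;> intro h <;> linarith
  have hexp : ∀ ω, θ * (√(a n) * ((empMean W n ω - P[W 0]) / (σ / √(n : ℝ)))) / a n =
      θ / σ * δ n * ∑ i ∈ Finset.range n, (W i ω - P[W 0]) := by
    intro ω
    have ha2 : a n = √(a n) ^ 2 := (Real.sq_sqrt h1.le).symm
    have hn2 : (n : ℝ) = √(n : ℝ) ^ 2 := (Real.sq_sqrt hn0.le).symm
    have hsa : 0 < √(a n) := Real.sqrt_pos.2 h1
    have hsn : 0 < √(n : ℝ) := Real.sqrt_pos.2 hn0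
    have hsum : ∑ i ∈ Finset.range n, (W i ω - P[W 0]) = n * (empMean W n ω - P[W 0]) := by
      rw [Finset.sum_sub_distrib, Finset.sum_const, Finset.card_range, nsmul_eq_mul, empMean,
        mul_sub, mul_div_cancel₀ _ hn0.ne']
    rw [hsum, show δ n = (√(a n) * √(n : ℝ))⁻¹ by rw [← Real.sqrt_mul h1.le]]
    generalize empMean W n ω - P[W 0] = v
    generalize √(n : ℝ) = q at *
    generalize √(a n) = b at *
    rw [ha2, hn2]
    field_simp
  rw [hset]
  simp only [hexp]
  rw [setIntegral_exp_sum_eq_pow hW hind hid h2]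
  exact hn

end

end SumMax

theorem mainTheorem1 {Ω : Type*} [MeasurableSpace Ω] (P : Measure Ω) [IsProbabilityMeasure P]
    (W : ℕ → Ω → ℝ) (hWmeas : ∀ i, Measurable (W i)) (hWindep : iIndepFun W P)
    (f : ℝ → ℝ) (m : EReal) (M : ℝ) (hf : SumMax.DensityAssumption f m M)
    (hWlaw : ∀ i, P.map (W i) = volume.withDensity (fun w => ENNReal.ofReal (f w)))
    (hderiv : HasDerivWithinAt (SumMax.distFun f) (f M) (Iic M) M) (hfM : 0 < f M)
    (L : ℕ → ℝ) (hL : Tendsto L atTop (𝓝 (f M)))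
    (a : ℕ → ℝ) (ha_pos : ∀ n, 1 ≤ n → 0 < a n) (ha_zero : Tendsto a atTop (𝓝 0))
    (ha_top : Tendsto (fun n : ℕ => a n * n) atTop atTop) :
    SumMax.SatisfiesLDP
        (fun n : ℕ => P.map (fun ω =>
          (√(a n) * ((SumMax.empMean W n ω - ∫ ω', W 0 ω' ∂P) / (√(variance (W 0) P) / √(n : ℝ))),
            a n * n * L n * (SumMax.partialMax W n ω - M))))
        (fun n => 1 / a n) SumMax.rateJ ∧
      SumMax.IsGoodRate SumMax.rateJ := by
  have hid : ∀ i, P.map (W i) = P.map (W 0) := fun i => (hWlaw i).trans (hWlaw 0).symm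
  have h0 := SumMax.zero_mem_interior_integrableExpSet (hWmeas 0) hf (hWlaw 0)
  have hWM : ∀ i, ∀ᵐ ω ∂P, W i ω ≤ M := fun i =>
    SumMax.ae_le_of_densityAssumption (hWmeas i) hf (hWlaw i)
  have hvar := SumMax.variance_pos_of_law_withDensity (hWmeas 0) h0 (hWlaw 0)
  have hderiv' : HasDerivWithinAt (fun z => P.real {ω | W 0 ω ≤ z}) (f M) (Iic M) M := by
    simpa only [SumMax.measureReal_le_eq_distFun (hWmeas 0) hf (hWlaw 0)] using hderiv
  have ha_pos' : ∀ᶠ n in atTop, 0 < a n := eventually_atTop.2 ⟨1, ha_pos⟩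
  have hmean : ∀ n, Measurable (SumMax.empMean W n) := fun n =>
    (Finset.measurable_sum _ fun i _ => hWmeas i).div_const _
  refine ⟨(SumMax.laplaceAsymptotics_mean_max hWmeas hWindep hid h0 (hWM 0) hderiv' hfM hvar hL
    ha_pos' ha_top).satisfiesLDP
      (fun n => (((hmean n).sub_const _).div_const _).const_mul _)
      (fun n => ((SumMax.measurable_partialMax hWmeas n).sub_const _).const_mul _)
      ha_pos' ha_zero ?_, SumMax.isGoodRate_rateJ⟩
  filter_upwards [ha_pos', hL.eventually_const_lt hfM, eventually_ne_atTop 0] with n h1 h2 h3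
  filter_upwards [ae_all_iff.2 hWM] with ω hω
  have hle := (SumMax.partialMax_le_iff h3).2 fun i : Fin n => hω i
  exact mul_nonpos_of_nonneg_of_nonpos (by positivity) (sub_nonpos.2 hle)
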